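/- A \emph{variety} is the class of all algebras of a given signature (a set of finitary operation symbols) that satisfy a given set of identities. An \emph{interpretation} of a variety $\mathcal V$ in a variety $\mathcal W$ is a map $\iota$ assigning to each basic operation symbol $f$ of $\mathcal V$ a term $\iota(f)$ of $\mathcal W$ of the same arity such that for every $\mathbf A\in\mathcal W$ the algebra $(A,(\iota(f)^{\mathbf A})_{f})$ belongs to $\mathcal V$. Write $\mathcal V\le\mathcal W$ if such an interpretation exists; this is a quasi-order on varieties, and the \emph{interpretability classes} are the classes of varieties that are interpretable in each other, partially ordered by $\le$. A variety is \emph{idempotent} if each of its basic operations satisfies $f(x,\dots,x)\approx x$. For $n\ge 2$, an \emph{$n$-cube term} of $\mathcal V$ is a $(2^n-1)$-ary term $c$ such that $c(\mathbf x_1,\dots,\mathbf x_{2^n-1})=(x,\dots,x)$ holds coordinatewise as identities of $\mathcal V$ in the variables $x,y$, where $\mathbf x_1,\dots,\mathbf x_{2^n-1}$ are all the $n$-tuples of $x$'s and $y$'s containing at least one $y$. A variety has a \emph{cube term} if it has an $n$-cube term for some $n\ge 2$. Fix $n\ge 2$. \begin{enumerate} \item[(i)] The class of all interpretability classes of idempotent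 varieties that do not have an $n$-cube term does not have a largest element. \item[(ii)] The class of all interpretability classes of idempotent varieties that do not have a cube term does not have a largest element. \end{enumerate} -/

import Mathlib

universe u

/-- A variety: a signature (a language without relation symbols, with a set of operation symbols
of each finite arity) together with the class of all algebras of that signature that satisfy some
set of identities `s ≈ t` between terms in the variables `0, 1, 2, …`. -/
structure Variety : Type (u + 1) where
  /-- The signature of the variety. -/
  sig : FirstOrder.Language.{u, 0}
  isAlgebraic : sig.IsAlgebraic
  /-- The class of algebras that belong to the variety. -/
  Mem : ∀ (A : Type u) [sig.Structure A], Prop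
  exists_identities : ∃ E : Set (sig.Term ℕ × sig.Term ℕ),
    ∀ (A : Type u) [sig.Structure A],
      Mem A ↔ ∀ e ∈ E, ∀ v : ℕ → A, e.1.realize v = e.2.realize v

namespace Variety

/-- The algebra `(A, (ι(f)^A)_f)` of signature `L` obtained from an algebra `A` of signature `L'`
and a map `ι` sending every `k`-ary operation symbol of `L` to a `k`-ary term of `L'`. -/
abbrev derivedAlgebra {L L' : FirstOrder.Language.{u, 0}} (hL : L.IsAlgebraic)
    (ι : ∀ k : ℕ, L.Functions k → L'.Term (Fin k)) (A : Type u) [L'.Structure A] :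
    L.Structure A where
  funMap := fun {k} f v => (ι k f).realize v
  RelMap := fun {k} r _ => (hL k).elim r

/-- `ι` is an interpretation of `V` in `W`. -/
def IsInterpretation (V W : Variety.{u})
    (ι : ∀ k : ℕ, V.sig.Functions k → W.sig.Term (Fin k)) : Prop :=
  ∀ (A : Type u) [W.sig.Structure A], W.Mem A →
    @Mem V A (derivedAlgebra V.isAlgebraic ι A)

/-- `V` is interpretable in `W`. -/
def Interpretable (V W : Variety.{u}) : Prop :=
  ∃ ι : ∀ k : ℕ, V.sig.Functions k → W.sig.Term (Fin k), IsInterpretation V W ι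

theorem Interpretable.refl (V : Variety.{u}) : Interpretable V V := by
  refine ⟨fun k f => f.term, fun A inst hA => ?_⟩
  have h : derivedAlgebra V.isAlgebraic (fun k (f : V.sig.Functions k) => f.term) A = inst := by
    apply FirstOrder.Language.Structure.ext
    · rfl
    · funext k r
      exact (V.isAlgebraic k).elim r
  rw [h]
  exact hA

theorem Interpretable.trans {U V W : Variety.{u}} (h₁ : Interpretable U V)
    (h₂ : Interpretable V W) : Interpretable U W := by
  obtain ⟨ι, hι⟩ := h₁
  obtain ⟨κ, hκ⟩ := h₂
  refine ⟨fun k f => (ι k f).substFunc (fun {m} g => κ m g), fun A inst hA => ?_⟩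
  let _ : V.sig.Structure A := derivedAlgebra V.isAlgebraic κ A
  have h : derivedAlgebra U.isAlgebraic
      (fun k f => (ι k f).substFunc (fun {m} g => κ m g)) A =
      derivedAlgebra U.isAlgebraic ι A := by
    apply FirstOrder.Language.Structure.ext
    · funext k f v
      exact FirstOrder.Language.Term.realize_substFunc (c := fun {m} g => κ m g)
        (fun _ _ => rfl) v (ι k f)
    · funext k r
      exact (U.isAlgebraic k).elim r
  rw [h]
  exact hι A (hκ A hA)

/-- The interpretability quasi-order: `V ≤ W` means that `V` is interpretable in `W`. -/
instance : Preorder Variety.{u} where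
  le := Interpretable
  le_refl := Interpretable.refl
  le_trans _ _ _ := Interpretable.trans

/-- The partially ordered class of interpretability types: varieties modulo interpretability
in each other. -/
abbrev InterpretabilityType : Type (u + 1) :=
  Antisymmetrization Variety.{u} (· ≤ ·)

/-- The interpretability class of a variety. -/
abbrev interpretabilityType (V : Variety.{u}) : InterpretabilityType.{u} :=
  toAntisymmetrization (· ≤ ·) V

/-- A variety is idempotent if all its basic operations `f` satisfy `f(x, …, x) ≈ x`. -/
def IsIdempotent (V : Variety.{u}) : Prop :=
  ∀ (A : Type u) [V.sig.Structure A], V.Mem A →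
    ∀ (k : ℕ) (f : V.sig.Functions k) (a : A), FirstOrder.Language.Structure.funMap f (fun _ => a) = a

/-- The `2 ^ n - 1` tuples of length `n` in the two letters `x` (coded by `false`) and `y`
(coded by `true`) that contain at least one `y`. -/
abbrev CubeIndex (n : ℕ) : Type :=
  {t : Fin n → Bool // ∃ i, t i = true}

/-- `V` has an `n`-cube term: a term `c` with one variable for each tuple `t` in `CubeIndex n`,
such that applying `c` coordinatewise to all these tuples yields `(x, …, x)`, identically in `V`:
for each coordinate `i` the variety satisfies `c((t i)_t) ≈ x`. -/
def HasCubeTermOfDim (V : Variety.{u}) (n : ℕ) : Prop :=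
  ∃ c : V.sig.Term (CubeIndex n),
    ∀ (A : Type u) [V.sig.Structure A], V.Mem A → ∀ (x y : A) (i : Fin n),
      c.realize (fun t : CubeIndex n => if t.1 i = true then y else x) = x

/-- `V` has a cube term, of some dimension `n ≥ 2`. -/
def HasCubeTerm (V : Variety.{u}) : Prop :=
  ∃ n : ℕ, 2 ≤ n ∧ HasCubeTermOfDim V n

end Variety

open FirstOrder.Language

namespace Variety

/-! The obstruction is cardinality: no variety without an `n`-cube term bounds all the varieties
`spreading I`. Such a variety has a nontrivial member `A`. An interpretation of `spreading (Set A)`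
would make `A` itself a member of it, and two distinct elements of `A` would then yield an injection
`Set A → A` (`spreading_injective_point`), against Cantor. Since `Set A` lives in the same universe
as `A`, it is an admissible index type. No `spreading I` has a cube term, because it has a member
with a blocking set (`not_hasCubeTermOfDim_of_blocks`), so one family settles both parts. -/

/-- If `V` has no `n`-cube term for some `n ≠ 0`, then `V` has a nontrivial member. -/
theorem exists_nontrivial_of_not_hasCubeTermOfDim {V : Variety.{u}} {n : ℕ} (hn : n ≠ 0)
    (hV : ¬ V.HasCubeTermOfDim n) :
    ∃ (A : Type u) (_ : V.sig.Structure A), V.Mem A ∧ Nontrivial A := by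
  by_contra! h
  -- Any term would do in a trivial variety; the all-`y` tuple is an available variable because `n ≠
  -- 0`.
  refine hV ⟨Term.var ⟨fun _ => true, ⟨0, Nat.pos_of_ne_zero hn⟩, rfl⟩, fun A inst hA x y i => ?_⟩
  have : Subsingleton A := h A inst hA
  exact Subsingleton.elim _ _

/-- A set `D` blocks an operation symbol if the value of the operation lies in `D` as soon as
the argument at some distinguished place does. -/
def Blocks {L : FirstOrder.Language.{u, 0}} {A : Type u} [L.Structure A] (D : Set A) : Prop :=
  ∀ (k : ℕ) (f : L.Functions k), ∃ i : Fin k, ∀ v : Fin k → A, v i ∈ D →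
    Structure.funMap f v ∈ D

/-- Following the distinguished places down the term tree ends at a variable that controls
membership in `D`. -/
theorem Blocks.exists_realize_mem {L : FirstOrder.Language.{u, 0}} {A : Type u} [L.Structure A] {D : Set A}
    (hD : Blocks (L := L) D) {α : Type*} (t : L.Term α) :
    ∃ a : α, ∀ v : α → A, v a ∈ D → t.realize v ∈ D := by
  induction t with
  | var a => exact ⟨a, fun v hv => hv⟩
  | func f ts ih =>
    obtain ⟨i, hi⟩ := hD _ f
    obtain ⟨a, ha⟩ := ih i
    exact ⟨a, fun v hv => hi _ (ha v hv)⟩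

/-- A variety with a member that has a nonempty proper subset blocking all basic operations has
no cube term. -/
theorem not_hasCubeTermOfDim_of_blocks {V : Variety.{u}} {A : Type u} [V.sig.Structure A]
    (hA : V.Mem A) {D : Set A} (hD : Blocks (L := V.sig) D) {x y : A} (hx : x ∉ D) (hy : y ∈ D)
    (n : ℕ) : ¬ V.HasCubeTermOfDim n := by
  rintro ⟨c, hc⟩
  obtain ⟨⟨t, i, hi⟩, h⟩ := hD.exists_realize_mem c
  -- The controlling variable is a tuple `t` with `t i = true`, so in the identity for coordinate
  -- `i` it receives `y ∈ D`, which forces `x ∈ D`.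
  refine hx (hc A hA x y i ▸ h _ ?_)
  simpa [hi] using hy

/-- Operation symbols of the variety `spreading I`. -/
inductive SpreadingOp (I : Type u) : ℕ → Type u
  | point (i : I) : SpreadingOp I 2
  | left : SpreadingOp I 4
  | right : SpreadingOp I 4

/-- The signature of the variety `spreading I`. -/
def spreadingSig (I : Type u) : FirstOrder.Language.{u, 0} :=
  ⟨SpreadingOp I, fun _ => Empty⟩

section

variable {I : Type u}

/-- The binary term `tᵢ(x, y)`. -/
def pointTerm (i : I) (x y : (spreadingSig I).Term ℕ) : (spreadingSig I).Term ℕ :=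
  Term.func (l := 2) (SpreadingOp.point i) ![x, y]

/-- The quaternary term `p(z, w, x, y)`. -/
def leftTerm (z w x y : (spreadingSig I).Term ℕ) : (spreadingSig I).Term ℕ :=
  Term.func (l := 4) SpreadingOp.left ![z, w, x, y]

/-- The quaternary term `q(z, w, x, y)`. -/
def rightTerm (z w x y : (spreadingSig I).Term ℕ) : (spreadingSig I).Term ℕ :=
  Term.func (l := 4) SpreadingOp.right ![z, w, x, y]

section Realize

variable {A : Type u} [(spreadingSig I).Structure A] (v : ℕ → A)
  (z w x y : (spreadingSig I).Term ℕ)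

theorem realize_pointTerm (i : I) : (pointTerm i x y).realize v =
    Structure.funMap (L := spreadingSig I) (n := 2) (SpreadingOp.point i)
      ![x.realize v, y.realize v] :=
  congrArg (Structure.funMap _) (by funext k; fin_cases k <;> rfl)

theorem realize_leftTerm : (leftTerm z w x y).realize v =
    Structure.funMap (L := spreadingSig I) (n := 4) SpreadingOp.left
      ![z.realize v, w.realize v, x.realize v, y.realize v] :=
  congrArg (Structure.funMap _) (by funext k; fin_cases k <;> rfl)

theorem realize_rightTerm : (rightTerm z w x y).realize v =
    Structure.funMap (L := spreadingSig I) (n := 4) SpreadingOp.right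
      ![z.realize v, w.realize v, x.realize v, y.realize v] :=
  congrArg (Structure.funMap _) (by funext k; fin_cases k <;> rfl)

end Realize

/-- The identities of `spreading I`: idempotence, `p(tᵢ(x, y), tⱼ(x, y), x, y) ≈ x` and
`q(tᵢ(x, y), tⱼ(x, y), x, y) ≈ y` for `i ≠ j`, and `p(z, z, x, y) ≈ q(z, z, x, y)`. -/
inductive SpreadingIdentity : (spreadingSig I).Term ℕ × (spreadingSig I).Term ℕ → Prop
  | idem {k : ℕ} (f : (spreadingSig I).Functions k) :
      SpreadingIdentity (Term.func f fun _ => Term.var 0, Term.var 0)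
  | left {i j : I} (h : i ≠ j) :
      SpreadingIdentity (leftTerm (pointTerm i (.var 0) (.var 1)) (pointTerm j (.var 0) (.var 1))
        (.var 0) (.var 1), .var 0)
  | right {i j : I} (h : i ≠ j) :
      SpreadingIdentity (rightTerm (pointTerm i (.var 0) (.var 1)) (pointTerm j (.var 0) (.var 1))
        (.var 0) (.var 1), .var 1)
  | left_right :
      SpreadingIdentity (leftTerm (.var 2) (.var 2) (.var 0) (.var 1),
        rightTerm (.var 2) (.var 2) (.var 0) (.var 1))

end

/-- The variety of all algebras with idempotent operations `tᵢ` (`i ∈ I`), `p`, `q` in which, for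
`x ≠ y`, the identities force the elements `tᵢ(x, y)` to be pairwise distinct. -/
def spreading (I : Type u) : Variety.{u} where
  sig := spreadingSig I
  isAlgebraic := fun _ => inferInstanceAs (IsEmpty Empty)
  Mem A _ := ∀ e : (spreadingSig I).Term ℕ × (spreadingSig I).Term ℕ, SpreadingIdentity e →
    ∀ v : ℕ → A, e.1.realize v = e.2.realize v
  exists_identities := ⟨{e | SpreadingIdentity e}, fun _ _ => Iff.rfl⟩

theorem spreading_isIdempotent (I : Type u) : (spreading I).IsIdempotent := fun _ _ hA _ f a =>
  hA _ (SpreadingIdentity.idem f) fun _ => a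

/-- For distinct `x`, `y` in a member of `spreading I`, the elements `tᵢ(x, y)` are distinct. -/
theorem spreading_injective_point {I A : Type u} [inst : (spreadingSig I).Structure A]
    (hA : @Mem (spreading I) A inst) {x y : A} (hxy : x ≠ y) :
    Function.Injective fun i : I =>
      Structure.funMap (L := spreadingSig I) (n := 2) (SpreadingOp.point i) ![x, y] := by
  intro i j hij
  by_contra hne
  set z := Structure.funMap (L := spreadingSig I) (n := 2) (SpreadingOp.point j) ![x, y]
  replace hij : Structure.funMap (L := spreadingSig I) (n := 2) (SpreadingOp.point i) ![x, y] = z :=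
    hij
  let v : ℕ → A := fun k => if k = 0 then x else if k = 1 then y else z
  have h0 : v 0 = x := rfl
  have h1 : v 1 = y := rfl
  have h2 : v 2 = z := rfl
  have hl := hA _ (SpreadingIdentity.left hne) v
  have hr := hA _ (SpreadingIdentity.right hne) v
  have hlr := hA _ SpreadingIdentity.left_right v
  simp only [realize_leftTerm, realize_rightTerm, realize_pointTerm, Term.realize_var, h0, h1, h2,
    hij] at hl hr hlr
  -- With `tᵢ(x, y) = tⱼ(x, y) = z`: `x = p(z, z, x, y) = q(z, z, x, y) = y`.
  exact hxy (hl.symm.trans (hlr.trans hr))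

section Model

open Classical in
/-- The operations of a member of `spreading I` on `Option (Option I)`. -/
noncomputable def spreadingModelFun (I : Type u) :
    ∀ {k : ℕ}, SpreadingOp I k → (Fin k → Option (Option I)) → Option (Option I)
  | _, .point i, v => if v 0 = v 1 then v 0 else some (some i)
  | _, .left, v => if v 0 ≠ v 1 ∨ v 2 = v 3 then v 2 else some none
  | _, .right, v => if v 0 ≠ v 1 ∨ v 2 = v 3 then v 3 else some none

/-- A member of `spreading I` in which the elements `some a` form a blocking set. -/
noncomputable abbrev spreadingModel (I : Type u) : (spreadingSig I).Structure (Option (Option I)) where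
  funMap f v := spreadingModelFun I f v
  RelMap r _ := r.elim

/-- For `x ≠ y` the values `tᵢ(x, y) = some (some i)` are distinct, so `p` and `q` act there as
projections to `x` and `y`; on equal first two arguments both give `some none`. For `x = y` every
identity reduces to idempotence. -/
theorem spreadingModel_mem (I : Type u) :
    @Mem (spreading I) (Option (Option I)) (spreadingModel I) := by
  let inst := spreadingModel I
  have hfun {k : ℕ} (f : SpreadingOp I k) (v : Fin k → Option (Option I)) :
      Structure.funMap (L := spreadingSig I) f v = spreadingModelFun I f v := rfl
  intro e he v
  cases he with
  | idem f =>
    change spreadingModelFun I f (fun _ => v 0) = v 0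
    cases f <;> simp [spreadingModelFun]
  | left h =>
    simp only [realize_leftTerm, realize_pointTerm, hfun, Term.realize_var]
    by_cases hv : v 0 = v 1 <;> simp [spreadingModelFun, hv, h]
  | right h =>
    simp only [realize_rightTerm, realize_pointTerm, hfun, Term.realize_var]
    by_cases hv : v 0 = v 1 <;> simp [spreadingModelFun, hv, h]
  | left_right =>
    simp only [realize_leftTerm, realize_rightTerm, hfun, Term.realize_var]
    by_cases hv : v 0 = v 1 <;> simp [spreadingModelFun, hv]

/-- Each operation returns either its argument at the chosen place or a value other than `none`. -/
theorem spreadingModel_blocks (I : Type u) :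
    @Blocks (spreadingSig I) (Option (Option I)) (spreadingModel I) (Set.range some) := by
  intro k f
  cases f with
  | point i =>
    refine ⟨0, fun v hv => ?_⟩
    simp only [Structure.funMap, spreadingModelFun]
    split_ifs
    exacts [hv, ⟨_, rfl⟩]
  | left =>
    refine ⟨2, fun v hv => ?_⟩
    simp only [Structure.funMap, spreadingModelFun]
    split_ifs
    exacts [hv, ⟨_, rfl⟩]
  | right =>
    refine ⟨3, fun v hv => ?_⟩
    simp only [Structure.funMap, spreadingModelFun]
    split_ifs
    exacts [hv, ⟨_, rfl⟩]

end Model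

theorem spreading_not_hasCubeTermOfDim (I : Type u) (n : ℕ) :
    ¬ (spreading I).HasCubeTermOfDim n :=
  let _ : (spreading I).sig.Structure (Option (Option I)) := spreadingModel I
  not_hasCubeTermOfDim_of_blocks (spreadingModel_mem I) (spreadingModel_blocks I)
    (x := none) (y := some none) (by simp) ⟨_, rfl⟩ n

/-- For every variety with a nontrivial member `A`, the variety `spreading (Set A)` is not
interpretable in it: its nontrivial members have at least as many elements as `A` has subsets. -/
theorem not_spreading_le {V : Variety.{u}} {A : Type u} [V.sig.Structure A] (hA : V.Mem A)
    [Nontrivial A] : ¬ spreading (Set A) ≤ V := by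
  rintro ⟨ι, hι⟩
  obtain ⟨x, y, hxy⟩ := exists_pair_ne A
  let _ : (spreadingSig (Set A)).Structure A := derivedAlgebra (spreading (Set A)).isAlgebraic ι A
  exact Function.cantor_injective _ (spreading_injective_point (hι A hA) hxy)

/-- A class of idempotent varieties without `n`-cube term that contains all varieties
`spreading I` has no largest interpretability type. -/
theorem not_exists_isGreatest_interpretabilityType {P : Variety.{u} → Prop} {n : ℕ} (hn : n ≠ 0)
    (hP : ∀ V, P V → ¬ V.HasCubeTermOfDim n) (hS : ∀ I, P (spreading I)) :
    ¬ ∃ m : InterpretabilityType.{u},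
      IsGreatest {c : InterpretabilityType.{u} | ∃ V : Variety.{u},
        V.IsIdempotent ∧ P V ∧ V.interpretabilityType = c} m := by
  rintro ⟨_, ⟨V, -, hV, rfl⟩, hmax⟩
  obtain ⟨A, _, hA, _⟩ := exists_nontrivial_of_not_hasCubeTermOfDim hn (hP V hV)
  exact not_spreading_le hA (toAntisymmetrization_le_toAntisymmetrization_iff.mp
    (hmax ⟨spreading (Set A), spreading_isIdempotent _, hS _, rfl⟩))

end Variety

theorem mainTheorem12 :
    (∀ n : ℕ, 2 ≤ n →
      ¬ ∃ m : Variety.InterpretabilityType.{u},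
        IsGreatest {c : Variety.InterpretabilityType.{u} | ∃ V : Variety.{u},
          V.IsIdempotent ∧ ¬ V.HasCubeTermOfDim n ∧ V.interpretabilityType = c} m) ∧
    ¬ ∃ m : Variety.InterpretabilityType.{u},
      IsGreatest {c : Variety.InterpretabilityType.{u} | ∃ V : Variety.{u},
        V.IsIdempotent ∧ ¬ V.HasCubeTerm ∧ V.interpretabilityType = c} m := by
  refine ⟨fun n hn => ?_, ?_⟩
  · exact Variety.not_exists_isGreatest_interpretabilityType
      (P := fun V => ¬ V.HasCubeTermOfDim n) (by omega) (fun _ h => h)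
      fun I => Variety.spreading_not_hasCubeTermOfDim I n
  · exact Variety.not_exists_isGreatest_interpretabilityType (P := fun V => ¬ V.HasCubeTerm)
      two_ne_zero (fun _ h h₂ => h ⟨2, le_rfl, h₂⟩)
      fun I ⟨n, _, h⟩ => Variety.spreading_not_hasCubeTermOfDim I n h
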